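/- Let $S=\{s_1,\dots,s_d\}$ be a finite alphabet, with formal inverses $s_1^{-1},\dots,s_d^{-1}$. A (finite) *system of equations* $E$ over $S$ is a finite set of formal equations $u=v$ between words $u,v$ over $S^{\pm}=\{s_1^{\pm1},\dots,s_d^{\pm1}\}$; its associated group is $\Gamma(E)=\langle S\mid uv^{-1}\text{ for each equation }u=v\text{ in }E\rangle$. For $n\ge 1$ and $\overline\sigma=(\sigma_1,\dots,\sigma_d)\in \mathrm{Sym}(n)^d$, let $w(\overline\sigma)$ be the permutation obtained from the word $w$ by substituting $s_j\mapsto\sigma_j$. Let $$\mathrm{SOL}_E(n)=\{\overline\sigma\in\mathrm{Sym}(n)^d : u(\overline\sigma)=v(\overline\sigma)\text{ for each equation }u=v\text{ in }E\},$$ $$\mathrm{SOL}_E^{\ge\varepsilon}(n)=\Big\{\overline\sigma\in\mathrm{Sym}(n)^d : \sum_{j=1}^d d^{\mathrm H}(\sigma_j,\tau_j)\ge\varepsilon\ \text{ for all } \overline\tau\in\mathrm{SOL}_E(n)\Big\},$$ where $d^{\mathrm H}(\sigma,\tau)=\frac1n|\{x:\sigma(x)\ne\tau(x)\}|$ is the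 normalized Hamming distance. An $(\varepsilon,q)$-*tester* for $E$ is a probabilistic algorithm that takes $n\ge 1$ as input, has oracle access to the entries of permutations $\sigma_1,\dots,\sigma_d\in\mathrm{Sym}(n)$ and of their inverses, may sample uniformly from finite sets, and, for all $n\geq 1$ and $\overline\sigma\in\mathrm{Sym}(n)^d$, * always halts, and makes at most $q$ (possibly adaptive) queries; * accepts with probability at least $0.99$ if $\overline\sigma\in\mathrm{SOL}_E(n)$; * rejects with probability at least $0.99$ if $\overline\sigma\in\mathrm{SOL}_E^{\ge\varepsilon}(n)$. The system $E$ is *testable* if for every $\varepsilon>0$ there are $q\in\mathbb N$ (independent of $n$) and an $(\varepsilon,q)$-tester for $E$. **Proposition.** Let $E_1$ and $E_2$ be systems of equations, over possibly different finite alphabets, such that the groups $\Gamma(E_1)$ and $\Gamma(E_2)$ are isomorphic. Then $E_1$ is testable if and only if $E_2$ is testable. -/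

import Mathlib

/-- Words over the alphabet with letters `s 0, …, s (d-1)` and their formal inverses:
`(i, true)` is the letter `s i` and `(i, false)` is its formal inverse
(the convention of `FreeGroup.mk`). -/
abbrev Word (d : ℕ) : Type := List (Fin d × Bool)

/-- A (finite) system of equations over an alphabet of `d` letters:
the pair `(u, v)` is the formal equation `u = v`. -/
abbrev EqSystem (d : ℕ) : Type := Finset (Word d × Word d)

namespace EqSystem

/-- The relators `u * v⁻¹` of the equations `u = v` of the system. -/
def relators {d : ℕ} (E : EqSystem d) : Set (FreeGroup (Fin d)) :=
  {r | ∃ e ∈ E, r = FreeGroup.mk e.1 * (FreeGroup.mk e.2)⁻¹}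

/-- The group `Γ(E)` presented by the alphabet and the system. -/
abbrev presentedGroup {d : ℕ} (E : EqSystem d) : Type := PresentedGroup E.relators

end EqSystem

/-- The permutation obtained by substituting `σ i` for the `i`-th letter in a word. The product
of permutations is the composition, the right factor acting first. -/
def Word.subst {d n : ℕ} (w : Word d) (σ : Fin d → Equiv.Perm (Fin n)) : Equiv.Perm (Fin n) :=
  (w.map fun s => if s.2 then σ s.1 else (σ s.1)⁻¹).prod

/-- The normalized Hamming distance on the permutations of `n` points. -/
noncomputable def hammingDistance {n : ℕ} (σ τ : Equiv.Perm (Fin n)) : ℝ :=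
  ((Finset.univ.filter fun x => σ x ≠ τ x).card : ℝ) / n

namespace EqSystem

/-- The solutions of `E` among the `d`-tuples of permutations of `n` points. -/
def solutions {d : ℕ} (E : EqSystem d) (n : ℕ) : Set (Fin d → Equiv.Perm (Fin n)) :=
  {σ | ∀ e ∈ E, Word.subst e.1 σ = Word.subst e.2 σ}

/-- The `d`-tuples of permutations that are at distance at least `ε` from every solution. -/
def farFromSolutions {d : ℕ} (E : EqSystem d) (ε : ℝ) (n : ℕ) :
    Set (Fin d → Equiv.Perm (Fin n)) :=
  {σ | ∀ τ ∈ E.solutions n, ε ≤ ∑ j, hammingDistance (σ j) (τ j)}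

end EqSystem

/-- What an oracle machine can do in one step.
* `query i b x`: read the entry at `x` of the `i`-th permutation (`b = true`)
  or of its inverse (`b = false`);
* `sample m`: draw an element of `{0, …, m}` uniformly at random, independently of all previous
  draws (`sample 0` returns `0`, and so it is a step without interaction);
* `halt b`: stop, and accept (`b = true`) or reject (`b = false`). -/
inductive Move (d : ℕ) : Type
  | query (i : Fin d) (b : Bool) (x : ℕ) : Move d
  | sample (m : ℕ) : Move d
  | halt (b : Bool) : Move d

/-- Moves as elements of a sum type; it only serves to give moves their evident encoding. -/
def Move.equivSum (d : ℕ) : Move d ≃ (Fin d × Bool × ℕ) ⊕ (ℕ ⊕ Bool) where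
  toFun
    | .query i b x => .inl (i, b, x)
    | .sample m => .inr (.inl m)
    | .halt b => .inr (.inr b)
  invFun
    | .inl (i, b, x) => .query i b x
    | .inr (.inl m) => .sample m
    | .inr (.inr b) => .halt b
  left_inv a := by cases a <;> rfl
  right_inv a := by rcases a with ⟨i, b, x⟩ | m | b <;> rfl

instance Move.primcodable (d : ℕ) : Primcodable (Move d) :=
  Primcodable.ofEquiv _ (Move.equivSum d)

/-- A probabilistic oracle machine with oracle access to `d` permutations. On input `n` it starts
in the configuration `start n`. In a configuration `c` it performs the move `move c`, and if the
response to a query or a draw is `r` it continues in the configuration `next c r`. All of this is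
given by computable functions. (A probabilistic oracle Turing machine is an example: take its
configurations, with its one-step transition function.) The machine is uniform in `n`, and learns
about the permutations only through its queries. -/
structure OracleMachine (d : ℕ) where
  /-- the configurations, coded by natural numbers -/
  Config : Type
  [primcodable : Primcodable Config]
  /-- the initial configuration on input `n` -/
  start : ℕ → Config
  /-- the move made in a configuration -/
  move : Config → Move d
  /-- the next configuration, given the response to the current move -/
  next : Config → ℕ → Config
  start_computable : Computable start
  move_computable : Computable move
  next_computable : Computable₂ next

/-- The oracle's answer to the query of the entry at `x` of the permutation `σ` (`b = true`) or of
its inverse (`b = false`). A query of a position outside of `{0, …, n-1}` yields no information: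
it just returns `x`. -/
def oracleAnswer {n : ℕ} (σ : Equiv.Perm (Fin n)) (b : Bool) (x : ℕ) : ℕ :=
  if h : x < n then (if b then σ ⟨x, h⟩ else σ⁻¹ ⟨x, h⟩ : Fin n) else x

namespace OracleMachine

/-- `M.Evaluates σ c q p`: when the machine runs from the configuration `c` with oracle `σ`, it
halts after finitely many steps whatever the random draws are, it never makes more than `q`
queries, and it accepts with probability exactly `p` (hence it rejects with probability
`1 - p`). -/
inductive Evaluates {d n : ℕ} (M : OracleMachine d) (σ : Fin d → Equiv.Perm (Fin n)) :
    M.Config → ℕ → ℝ → Prop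
  | accept (c : M.Config) (q : ℕ) (hc : M.move c = .halt true) : Evaluates M σ c q 1
  | reject (c : M.Config) (q : ℕ) (hc : M.move c = .halt false) : Evaluates M σ c q 0
  | query (c : M.Config) (q : ℕ) (p : ℝ) (i : Fin d) (b : Bool) (x : ℕ)
      (hc : M.move c = .query i b x)
      (h : Evaluates M σ (M.next c (oracleAnswer (σ i) b x)) q p) :
      Evaluates M σ c (q + 1) p
  | sample (c : M.Config) (q m : ℕ) (p : Fin (m + 1) → ℝ)
      (hc : M.move c = .sample m)
      (h : ∀ r : Fin (m + 1), Evaluates M σ (M.next c r) q (p r)) :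
      Evaluates M σ c q ((∑ r, p r) / ((m : ℝ) + 1))

/-- `M` is an `(ε, q)`-tester for the system `E`: on every input it halts, making at most `q`
queries; it accepts every solution with probability at least `0.99`; and it rejects every tuple at
distance at least `ε` from all solutions with probability at least `0.99`. -/
def IsTester {d : ℕ} (M : OracleMachine d) (E : EqSystem d) (ε : ℝ) (q : ℕ) : Prop :=
  ∀ n : ℕ, 1 ≤ n → ∀ σ : Fin d → Equiv.Perm (Fin n),
    ∃ p : ℝ, M.Evaluates σ (M.start n) q p ∧
      (σ ∈ E.solutions n → (0.99 : ℝ) ≤ p) ∧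
      (σ ∈ E.farFromSolutions ε n → (0.99 : ℝ) ≤ 1 - p)

end OracleMachine

/-- The system `E` is testable: for every `ε > 0` there are a number `q` (not depending on `n`)
and an `(ε, q)`-tester for `E`. -/
def EqSystem.Testable {d : ℕ} (E : EqSystem d) : Prop :=
  ∀ ε : ℝ, 0 < ε → ∃ (q : ℕ) (M : OracleMachine d), M.IsTester E ε q

/-! Solutions of a system in `Sym(n)` are the homomorphisms from its group to `Sym(n)`. An
isomorphism `Γ(E) ≃ Γ(F)` and its inverse lift to tuples of words `a` and `b`, and substitution of
these words carries solutions of one system to solutions of the other.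

To test `σ` against `F`, run a tester for `E` on the tuple `a(σ)`, each query being answered by
following a word of bounded length. This alone does not suffice: `a(σ)` may be close to a solution
even if `σ` is far from all of them. So it is also checked, at random points, that `σ j` agrees with
`b j` evaluated at `a(σ)`, an identity that every solution of `F` satisfies. If `a(σ)` is close to a
solution `τ` of `E`, then, words being Lipschitz for the Hamming distance, `b(a(σ))` is close to the
solution `b(τ)` of `F`. As `σ` is far from `b(τ)`, it is far from `b(a(σ))`, and repeated checks
detect this. On solutions the checks never fail, so no acceptance probability is lost.

The simulation is `exists_pull`, the repeated checks are `exists_guard_pow`, the Lipschitz bound is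
`hammingDistance_subst_le`, and `Testable.of_mulEquiv` combines them. -/

namespace Word

theorem subst_eq_lift {d n : ℕ} (w : Word d) (σ : Fin d → Equiv.Perm (Fin n)) :
    w.subst σ = FreeGroup.lift σ (FreeGroup.mk w) := by
  rw [FreeGroup.lift_mk, Word.subst]
  congr 2
  funext s
  rcases s with ⟨i, _ | _⟩ <;> rfl

theorem subst_cons {d n : ℕ} (s : Fin d × Bool) (w : Word d) (σ : Fin d → Equiv.Perm (Fin n)) :
    Word.subst (s :: w) σ = (if s.2 then σ s.1 else (σ s.1)⁻¹) * Word.subst w σ := by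
  simp [Word.subst]

/-- Follow the letters of a word from a point, the first letter acting first, by means of the
oracle. -/
def trace {d n : ℕ} (σ : Fin d → Equiv.Perm (Fin n)) (w : Word d) (x : ℕ) : ℕ :=
  w.foldl (fun y s => oracleAnswer (σ s.1) s.2 y) x

end Word

theorem oracleAnswer_mul {n : ℕ} (σ τ : Equiv.Perm (Fin n)) (x : ℕ) :
    oracleAnswer (σ * τ) true x = oracleAnswer σ true (oracleAnswer τ true x) := by
  unfold oracleAnswer
  by_cases h : x < n <;> simp [h]

theorem oracleAnswer_eq_true {n : ℕ} (σ : Equiv.Perm (Fin n)) (b : Bool) (x : ℕ) :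
    oracleAnswer σ b x = oracleAnswer (if b then σ else σ⁻¹) true x := by
  cases b <;> simp [oracleAnswer]

theorem oracleAnswer_one {n : ℕ} (x : ℕ) :
    oracleAnswer (1 : Equiv.Perm (Fin n)) true x = x := by
  unfold oracleAnswer
  by_cases h : x < n <;> simp [h]

/-- The reversal appears because in a product of permutations the last letter acts first. No bound
on `x` is needed, since the oracle fixes positions out of range. -/
theorem Word.trace_reverse {d n : ℕ} (σ : Fin d → Equiv.Perm (Fin n)) (w : Word d) (x : ℕ) :
    Word.trace σ w.reverse x = oracleAnswer (w.subst σ) true x := by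
  induction w with
  | nil => simp [Word.trace, Word.subst, oracleAnswer_one]
  | cons s w ih =>
    rw [Word.subst_cons, oracleAnswer_mul, ← ih, ← oracleAnswer_eq_true]
    simp [Word.trace]

/-! ### The Hamming metric: bi-invariance and Lipschitz continuity of words -/

section Hamming

variable {n : ℕ}

theorem hammingDistance_nonneg (σ τ : Equiv.Perm (Fin n)) : 0 ≤ hammingDistance σ τ := by
  unfold hammingDistance; positivity

theorem hammingDistance_self (σ : Equiv.Perm (Fin n)) : hammingDistance σ σ = 0 := by
  simp [hammingDistance]

theorem hammingDistance_le_one (σ τ : Equiv.Perm (Fin n)) : hammingDistance σ τ ≤ 1 := by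
  unfold hammingDistance
  refine div_le_one_of_le₀ ?_ (by positivity)
  exact_mod_cast (Finset.card_filter_le _ _).trans (by simp)

theorem hammingDistance_triangle (ρ σ τ : Equiv.Perm (Fin n)) :
    hammingDistance ρ τ ≤ hammingDistance ρ σ + hammingDistance σ τ := by
  unfold hammingDistance
  rw [← add_div]
  refine div_le_div_of_nonneg_right ?_ (by positivity)
  norm_cast
  refine (Finset.card_le_card ?_).trans (Finset.card_union_le _ _)
  intro x hx
  simp only [Finset.mem_filter, Finset.mem_univ, true_and, Finset.mem_union] at hx ⊢
  by_contra! h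
  exact hx (h.1.trans h.2)

theorem hammingDistance_mul_left (ρ σ τ : Equiv.Perm (Fin n)) :
    hammingDistance (ρ * σ) (ρ * τ) = hammingDistance σ τ := by
  simp [hammingDistance]

theorem hammingDistance_mul_right (ρ σ τ : Equiv.Perm (Fin n)) :
    hammingDistance (σ * ρ) (τ * ρ) = hammingDistance σ τ := by
  have h : (Finset.univ.filter fun x => (σ * ρ) x ≠ (τ * ρ) x).card =
      (Finset.univ.filter fun x => σ x ≠ τ x).card :=
    Finset.card_equiv ρ fun x => by
      rw [Finset.mem_filter_univ, Finset.mem_filter_univ]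
      rfl
  rw [hammingDistance, h, hammingDistance]

theorem hammingDistance_comm (σ τ : Equiv.Perm (Fin n)) :
    hammingDistance σ τ = hammingDistance τ σ := by
  simp [hammingDistance, ne_comm]

theorem hammingDistance_inv (σ τ : Equiv.Perm (Fin n)) :
    hammingDistance σ⁻¹ τ⁻¹ = hammingDistance σ τ := by
  rw [← hammingDistance_mul_left σ, ← hammingDistance_mul_right τ]
  simp [hammingDistance_comm]

/-- By bi-invariance the letters can be exchanged one at a time, each at the cost of the distance at
a single generator. -/
theorem hammingDistance_subst_le {d : ℕ} (w : Word d) (σ τ : Fin d → Equiv.Perm (Fin n)) :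
    hammingDistance (w.subst σ) (w.subst τ) ≤
      w.length * ∑ i, hammingDistance (σ i) (τ i) := by
  induction w with
  | nil => simp [Word.subst, hammingDistance_self]
  | cons s w ih =>
    rw [Word.subst_cons, Word.subst_cons]
    refine (hammingDistance_triangle _
      ((if s.2 then σ s.1 else (σ s.1)⁻¹) * Word.subst w τ) _).trans ?_
    rw [hammingDistance_mul_left, hammingDistance_mul_right]
    have h : hammingDistance (if s.2 then σ s.1 else (σ s.1)⁻¹)
        (if s.2 then τ s.1 else (τ s.1)⁻¹) ≤ ∑ i, hammingDistance (σ i) (τ i) := by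
      have h' : hammingDistance (if s.2 then σ s.1 else (σ s.1)⁻¹)
          (if s.2 then τ s.1 else (τ s.1)⁻¹) = hammingDistance (σ s.1) (τ s.1) := by
        cases s.2 <;> simp [hammingDistance_inv]
      rw [h']
      exact Finset.single_le_sum (f := fun i => hammingDistance (σ i) (τ i))
        (fun i _ => hammingDistance_nonneg _ _) (Finset.mem_univ _)
    push_cast [List.length_cons]
    linarith

end Hamming

/-! ### Computability of moves and general facts on runs of machines -/

namespace Move

theorem equivSum_computable (d : ℕ) : Computable (Move.equivSum d) :=
  (Primrec.of_equiv (e := Move.equivSum d)).to_comp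

theorem equivSum_symm_primrec (d : ℕ) : Primrec (Move.equivSum d).symm :=
  Primrec.of_equiv_symm (e := Move.equivSum d)

theorem query_computable {d : ℕ} {α : Type*} [Primcodable α] {i : α → Fin d} {b : α → Bool}
    {x : α → ℕ} (hi : Computable i) (hb : Computable b) (hx : Computable x) :
    Computable fun t => (Move.query (i t) (b t) (x t) : Move d) :=
  (equivSum_symm_primrec d).to_comp.comp (Computable.sumInl.comp (hi.pair (hb.pair hx)))

theorem sample_primrec (d : ℕ) : Primrec fun m : ℕ => (Move.sample m : Move d) :=
  (equivSum_symm_primrec d).comp (Primrec.sumInr.comp Primrec.sumInl)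

end Move

namespace OracleMachine

instance instPrimcodableConfig {d : ℕ} (M : OracleMachine d) : Primcodable M.Config :=
  M.primcodable

theorem Evaluates.mono {d n : ℕ} {M : OracleMachine d} {σ : Fin d → Equiv.Perm (Fin n)}
    {c : M.Config} {q : ℕ} {p : ℝ} (h : M.Evaluates σ c q p) :
    ∀ {q' : ℕ}, q ≤ q' → M.Evaluates σ c q' p := by
  induction h with
  | accept c q hc => exact fun _ => .accept c _ hc
  | reject c q hc => exact fun _ => .reject c _ hc
  | query c q p i b x hc _ ih =>
    intro q' hq
    obtain ⟨k, rfl⟩ : ∃ k, q' = k + 1 := ⟨q' - 1, by omega⟩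
    exact .query c k p i b x hc (ih (by omega))
  | sample c q m p hc _ ih => exact fun hq => .sample c _ m p hc fun r => ih r hq

theorem Evaluates.mem_Icc {d n : ℕ} {M : OracleMachine d} {σ : Fin d → Equiv.Perm (Fin n)}
    {c : M.Config} {q : ℕ} {p : ℝ} (h : M.Evaluates σ c q p) : p ∈ Set.Icc (0 : ℝ) 1 := by
  induction h with
  | accept c q hc => simp
  | reject c q hc => simp
  | query c q p i b x hc _ ih => exact ih
  | sample c q m p hc _ ih =>
    refine ⟨div_nonneg (Finset.sum_nonneg fun r _ => (ih r).1) (by positivity), ?_⟩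
    refine div_le_one_of_le₀ ?_ (by positivity)
    calc ∑ r, p r ≤ ∑ _r : Fin (m + 1), (1 : ℝ) := Finset.sum_le_sum fun r _ => (ih r).2
      _ = (m : ℝ) + 1 := by simp

/-- A draw from a single value serves as a silent step, in which a machine only updates its
configuration. -/
theorem Evaluates.skip {d n : ℕ} {M : OracleMachine d} {σ : Fin d → Equiv.Perm (Fin n)}
    {c : M.Config} {q : ℕ} {p : ℝ} (hc : M.move c = .sample 0)
    (h : M.Evaluates σ (M.next c 0) q p) : M.Evaluates σ c q p := by
  have := Evaluates.sample (σ := σ) c q 0 (fun _ => p) hc (fun r => by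
    rw [Fin.eq_zero r]; exact h)
  simpa using this

/-! ### Substituting words into the oracle of a machine -/

section Pull

variable {d e : ℕ} (M : OracleMachine d) (a : Fin d → FreeGroup (Fin e))

/-- The letters to be followed to answer a query, the first letter acting first. -/
def pullWord (s : Fin d × Bool) : Word e :=
  (FreeGroup.toWord (if s.2 then a s.1 else (a s.1)⁻¹)).reverse

/-- The move of the machine `pull`. -/
def pullMove (c : M.Config × Option (Word e × ℕ)) : Move e :=
  Option.casesOn c.2
    (Sum.casesOn (Move.equivSum d (M.move c.1)) (fun _ => .sample 0)
      (fun t => (Move.equivSum e).symm (.inr t)))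
    (fun y => Option.casesOn y.1.head? (.sample 0) (fun s => .query s.1 s.2 y.2))

/-- The transition function of the machine `pull`. -/
def pullNext (c : M.Config × Option (Word e × ℕ)) (r : ℕ) : M.Config × Option (Word e × ℕ) :=
  Option.casesOn c.2
    (Sum.casesOn (Move.equivSum d (M.move c.1))
      (fun t => (c.1, some (pullWord a (t.1, t.2.1), t.2.2))) (fun _ => (M.next c.1 r, none)))
    (fun y => Option.casesOn y.1.head? (M.next c.1 y.2, none)
      (fun _ => (c.1, some (y.1.tail, r))))

theorem pullMove_computable : Computable (M.pullMove (e := e)) := by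
  have hrun : Computable fun c : M.Config × Option (Word e × ℕ) =>
      (Sum.casesOn (Move.equivSum d (M.move c.1)) (fun _ => .sample 0)
        (fun t => (Move.equivSum e).symm (.inr t)) : Move e) := by
    have h : Computable₂ fun (_ : M.Config × Option (Word e × ℕ)) (t : ℕ ⊕ Bool) =>
        (Move.equivSum e).symm (.inr t) :=
      (Move.equivSum_symm_primrec e).to_comp.comp (Computable.sumInr.comp Computable.snd)
    exact Computable.sumCasesOn
      ((Move.equivSum_computable d).comp (M.move_computable.comp Computable.fst))
      (Computable.const _).to₂ h
  have hask : Computable₂ fun (_ : M.Config × Option (Word e × ℕ)) (y : Word e × ℕ) =>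
      (Option.casesOn y.1.head? (.sample 0) (fun s => .query s.1 s.2 y.2) : Move e) := by
    have h : Computable₂ fun (z : (M.Config × Option (Word e × ℕ)) × (Word e × ℕ))
        (s : Fin e × Bool) => (Move.query s.1 s.2 z.2.2 : Move e) :=
      Move.query_computable (Computable.fst.comp Computable.snd)
        (Computable.snd.comp Computable.snd)
        (Computable.snd.comp (Computable.snd.comp Computable.fst))
    exact Computable.option_casesOn
      (Primrec.list_head?.to_comp.comp (Computable.fst.comp Computable.snd))
      (Computable.const _) h
  exact Computable.option_casesOn Computable.snd hrun hask

theorem pullNext_computable : Computable₂ (M.pullNext a) := by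
  have hrun : Computable fun z : (M.Config × Option (Word e × ℕ)) × ℕ =>
      (Sum.casesOn (Move.equivSum d (M.move z.1.1))
        (fun t => (z.1.1, some (pullWord a (t.1, t.2.1), t.2.2)))
        (fun _ => (M.next z.1.1 z.2, none)) : M.Config × Option (Word e × ℕ)) := by
    have h₁ : Computable₂ fun (z : (M.Config × Option (Word e × ℕ)) × ℕ)
        (t : Fin d × Bool × ℕ) => (z.1.1, some (pullWord a (t.1, t.2.1), t.2.2)) := by
      -- There are finitely many letters, so `pullWord a` is a finite table; computability of
      -- reduced words is not at issue.
      have hw : Computable fun u : ((M.Config × Option (Word e × ℕ)) × ℕ) × (Fin d × Bool × ℕ) =>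
          pullWord a (u.2.1, u.2.2.1) :=
        (Primrec.dom_finite (pullWord a)).to_comp.comp ((Computable.fst.comp Computable.snd).pair
          (Computable.fst.comp (Computable.snd.comp Computable.snd)))
      exact (Computable.fst.comp (Computable.fst.comp Computable.fst)).pair
        (Computable.option_some.comp (hw.pair
          (Computable.snd.comp (Computable.snd.comp Computable.snd))))
    have h₂ : Computable₂ fun (z : (M.Config × Option (Word e × ℕ)) × ℕ) (_ : ℕ ⊕ Bool) =>
        ((M.next z.1.1 z.2, none) : M.Config × Option (Word e × ℕ)) :=
      (M.next_computable.comp (Computable.fst.comp (Computable.fst.comp Computable.fst))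
        (Computable.snd.comp Computable.fst)).pair (Computable.const none)
    exact Computable.sumCasesOn ((Move.equivSum_computable d).comp
      (M.move_computable.comp (Computable.fst.comp Computable.fst))) h₁ h₂
  have hask : Computable₂ fun (z : (M.Config × Option (Word e × ℕ)) × ℕ) (y : Word e × ℕ) =>
      (Option.casesOn y.1.head? (M.next z.1.1 y.2, none)
        (fun _ => (z.1.1, some (y.1.tail, z.2))) : M.Config × Option (Word e × ℕ)) := by
    have h₁ : Computable fun u : ((M.Config × Option (Word e × ℕ)) × ℕ) × (Word e × ℕ) =>
        ((M.next u.1.1.1 u.2.2, none) : M.Config × Option (Word e × ℕ)) :=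
      (M.next_computable.comp (Computable.fst.comp (Computable.fst.comp Computable.fst))
        (Computable.snd.comp Computable.snd)).pair (Computable.const none)
    have h₂ : Computable₂ fun (u : ((M.Config × Option (Word e × ℕ)) × ℕ) × (Word e × ℕ))
        (_ : Fin e × Bool) => (u.1.1.1, some (u.2.1.tail, u.1.2)) :=
      (Computable.fst.comp (Computable.fst.comp (Computable.fst.comp Computable.fst))).pair
        (Computable.option_some.comp ((Primrec.list_tail.to_comp.comp (Computable.fst.comp
          (Computable.snd.comp Computable.fst))).pair
            (Computable.snd.comp (Computable.fst.comp Computable.fst))))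
    exact Computable.option_casesOn
      (Primrec.list_head?.to_comp.comp (Computable.fst.comp Computable.snd)) h₁ h₂
  exact Computable.option_casesOn (Computable.snd.comp Computable.fst) hrun hask

/-- A machine that runs `M` with the permutations `a i` evaluated at its own oracle. It keeps
the configuration of `M` and, while it answers a query of `M`, the letters still to be followed
and the current point. -/
def pull : OracleMachine e where
  Config := M.Config × Option (Word e × ℕ)
  start n := (M.start n, none)
  move := M.pullMove
  next := M.pullNext a
  start_computable := M.start_computable.pair (Computable.const none)
  move_computable := M.pullMove_computable
  next_computable := M.pullNext_computable a

theorem trace_pullWord {n : ℕ} (σ : Fin e → Equiv.Perm (Fin n)) (i : Fin d) (b : Bool) (x : ℕ) :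
    Word.trace σ (pullWord a (i, b)) x = oracleAnswer (FreeGroup.lift σ (a i)) b x := by
  rw [pullWord, Word.trace_reverse, Word.subst_eq_lift, FreeGroup.mk_toWord,
    oracleAnswer_eq_true _ b]
  cases b <;> simp

theorem pull_evaluates_word {n : ℕ} (σ : Fin e → Equiv.Perm (Fin n)) (c : M.Config) (q : ℕ)
    (p : ℝ) (w : Word e) : ∀ x : ℕ,
    (M.pull a).Evaluates σ (M.next c (Word.trace σ w x), none) q p →
    (M.pull a).Evaluates σ (c, some (w, x)) (q + w.length) p := by
  induction w with
  | nil => exact fun x h => Evaluates.skip (M := M.pull a) rfl h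
  | cons s w ih =>
    exact fun x h => Evaluates.query (M := M.pull a) _ _ _ s.1 s.2 x rfl (ih _ h)

theorem pull_evaluates {n : ℕ} (σ : Fin e → Equiv.Perm (Fin n)) {c : M.Config} {q L : ℕ} {p : ℝ}
    (hL : ∀ s, (pullWord a s).length ≤ L)
    (h : M.Evaluates (fun i => FreeGroup.lift σ (a i)) c q p) :
    (M.pull a).Evaluates σ (c, none) (q * L) p := by
  induction h with
  | accept c q hc => exact .accept (M := M.pull a) _ _ (by simp [pull, pullMove, hc, Move.equivSum])
  | reject c q hc => exact .reject (M := M.pull a) _ _ (by simp [pull, pullMove, hc, Move.equivSum])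
  | query c q p i b x hc _ ih =>
    refine Evaluates.skip (M := M.pull a) (by simp [pull, pullMove, hc, Move.equivSum]) ?_
    have hn : (M.pull a).next (c, none) 0 = (c, some (pullWord a (i, b), x)) := by
      simp [pull, pullNext, hc, Move.equivSum]
    rw [hn]
    refine Evaluates.mono (M.pull_evaluates_word a σ c (q * L) p _ x ?_)
      (by have := hL (i, b); rw [Nat.succ_mul]; omega)
    rw [trace_pullWord]
    exact ih
  | sample c q m p hc _ ih =>
    refine .sample (M := M.pull a) _ _ m p (by simp [pull, pullMove, hc, Move.equivSum]) fun r => ?_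
    have hn : (M.pull a).next (c, none) r = (M.next c r, none) := by
      simp [pull, pullNext, hc, Move.equivSum]
    rw [hn]
    exact ih r

theorem exists_pull : ∃ (M' : OracleMachine e) (L : ℕ),
    ∀ (n : ℕ) (σ : Fin e → Equiv.Perm (Fin n)) (q : ℕ) (p : ℝ),
      M.Evaluates (fun i => FreeGroup.lift σ (a i)) (M.start n) q p →
      M'.Evaluates σ (M'.start n) (q * L) p :=
  ⟨M.pull a, Finset.univ.sup fun s => (pullWord a s).length, fun _ σ _ _ h =>
    M.pull_evaluates a σ (fun s => Finset.le_sup (f := fun s => (pullWord a s).length)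
      (Finset.mem_univ s)) h⟩

end Pull

/-! ### Checking a relation at a random point before running a machine -/

section Guard

variable {d : ℕ} (M : OracleMachine d) (w : Word d)

/-- The configurations of the machine `guard`. -/
abbrev GuardConfig : Type := M.Config ⊕ (ℕ × Option (ℕ × Word d × ℕ))

/-- The move of the machine `guard`. -/
def guardMove (c : M.GuardConfig) : Move d :=
  Sum.casesOn c M.move fun t =>
    Option.casesOn t.2 (.sample (t.1 - 1)) fun y =>
      Option.casesOn y.2.1.head? (bif y.1 == y.2.2 then .sample 0 else .halt false)
        fun s => .query s.1 s.2 y.2.2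

/-- The transition function of the machine `guard`. -/
def guardNext (c : M.GuardConfig) (r : ℕ) : M.GuardConfig :=
  Sum.casesOn c (fun c => .inl (M.next c r)) fun t =>
    Option.casesOn t.2 (.inr (t.1, some (r, w, r))) fun y =>
      Option.casesOn y.2.1.head? (.inl (M.start t.1))
        fun _ => .inr (t.1, some (y.1, y.2.1.tail, r))

theorem guardMove_computable : Computable M.guardMove := by
  have hask : Computable₂ fun (_ : M.GuardConfig × (ℕ × Option (ℕ × Word d × ℕ)))
      (y : ℕ × Word d × ℕ) =>
      (Option.casesOn y.2.1.head? (bif y.1 == y.2.2 then .sample 0 else .halt false)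
        fun s => .query s.1 s.2 y.2.2 : Move d) := by
    have h₁ : Computable fun u : (M.GuardConfig × (ℕ × Option (ℕ × Word d × ℕ))) ×
        (ℕ × Word d × ℕ) => (bif u.2.1 == u.2.2.2 then .sample 0 else .halt false : Move d) := by
      refine Computable.cond ?_ (Computable.const _) (Computable.const _)
      exact (Primrec.beq (α := ℕ)).to_comp.comp (Computable.fst.comp Computable.snd)
        (Computable.snd.comp (Computable.snd.comp Computable.snd))
    have h₂ : Computable₂ fun (u : (M.GuardConfig × (ℕ × Option (ℕ × Word d × ℕ))) ×
        (ℕ × Word d × ℕ)) (s : Fin d × Bool) => (Move.query s.1 s.2 u.2.2.2 : Move d) :=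
      Move.query_computable (Computable.fst.comp Computable.snd)
        (Computable.snd.comp Computable.snd)
        (Computable.snd.comp (Computable.snd.comp (Computable.snd.comp Computable.fst)))
    exact Computable.option_casesOn (Primrec.list_head?.to_comp.comp
      (Computable.fst.comp (Computable.snd.comp Computable.snd))) h₁ h₂
  have hcheck : Computable₂ fun (_ : M.GuardConfig) (t : ℕ × Option (ℕ × Word d × ℕ)) =>
      (Option.casesOn t.2 (.sample (t.1 - 1)) fun y =>
        Option.casesOn y.2.1.head? (bif y.1 == y.2.2 then .sample 0 else .halt false)
          fun s => .query s.1 s.2 y.2.2 : Move d) :=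
    Computable.option_casesOn (Computable.snd.comp Computable.snd)
      ((Move.sample_primrec d).to_comp.comp
        (Primrec.pred.to_comp.comp (Computable.fst.comp Computable.snd))) hask
  exact Computable.sumCasesOn Computable.id (M.move_computable.comp Computable.snd).to₂ hcheck

theorem guardNext_computable : Computable₂ (M.guardNext w) := by
  have hask : Computable₂ fun (z : (M.GuardConfig × ℕ) × (ℕ × Option (ℕ × Word d × ℕ)))
      (y : ℕ × Word d × ℕ) =>
      (Option.casesOn y.2.1.head? (.inl (M.start z.2.1))
        fun _ => .inr (z.2.1, some (y.1, y.2.1.tail, z.1.2)) : M.GuardConfig) := by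
    have h₁ : Computable fun u : ((M.GuardConfig × ℕ) × (ℕ × Option (ℕ × Word d × ℕ))) ×
        (ℕ × Word d × ℕ) => (.inl (M.start u.1.2.1) : M.GuardConfig) :=
      Computable.sumInl.comp (M.start_computable.comp
        (Computable.fst.comp (Computable.snd.comp Computable.fst)))
    have h₂ : Computable₂ fun (u : ((M.GuardConfig × ℕ) × (ℕ × Option (ℕ × Word d × ℕ))) ×
        (ℕ × Word d × ℕ)) (_ : Fin d × Bool) =>
        (.inr (u.1.2.1, some (u.2.1, u.2.2.1.tail, u.1.1.2)) : M.GuardConfig) := by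
      have htail : Computable fun v : (((M.GuardConfig × ℕ) × (ℕ × Option (ℕ × Word d × ℕ))) ×
          (ℕ × Word d × ℕ)) × (Fin d × Bool) => v.1.2.2.1.tail :=
        Primrec.list_tail.to_comp.comp (Computable.fst.comp
          (Computable.snd.comp (Computable.snd.comp Computable.fst)))
      exact Computable.sumInr.comp
        ((Computable.fst.comp (Computable.snd.comp (Computable.fst.comp Computable.fst))).pair
          (Computable.option_some.comp
            ((Computable.fst.comp (Computable.snd.comp Computable.fst)).pair
              (htail.pair
                (Computable.snd.comp (Computable.fst.comp
                  (Computable.fst.comp Computable.fst)))))))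
    exact Computable.option_casesOn (Primrec.list_head?.to_comp.comp
      (Computable.fst.comp (Computable.snd.comp Computable.snd))) h₁ h₂
  have hdraw : Computable fun z : (M.GuardConfig × ℕ) × (ℕ × Option (ℕ × Word d × ℕ)) =>
      (.inr (z.2.1, some (z.1.2, w, z.1.2)) : M.GuardConfig) :=
    Computable.sumInr.comp ((Computable.fst.comp Computable.snd).pair
      (Computable.option_some.comp ((Computable.snd.comp Computable.fst).pair
        ((Computable.const w).pair (Computable.snd.comp Computable.fst)))))
  have hcheck : Computable₂ fun (z : M.GuardConfig × ℕ) (t : ℕ × Option (ℕ × Word d × ℕ)) =>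
      (Option.casesOn t.2 (.inr (t.1, some (z.2, w, z.2))) fun y =>
        Option.casesOn y.2.1.head? (.inl (M.start t.1))
          fun _ => .inr (t.1, some (y.1, y.2.1.tail, z.2)) : M.GuardConfig) :=
    Computable.option_casesOn (Computable.snd.comp Computable.snd) hdraw hask
  have hrun : Computable₂ fun (z : M.GuardConfig × ℕ) (c : M.Config) =>
      (.inl (M.next c z.2) : M.GuardConfig) :=
    Computable.sumInl.comp (M.next_computable.comp Computable.snd
      (Computable.snd.comp Computable.fst))
  exact Computable.sumCasesOn Computable.fst hrun hcheck

/-- A machine that draws a random point `x`, follows the letters of `w` from `x`, the first letter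
acting first, rejects if it does not come back to `x`, and otherwise runs `M`. Before it runs
`M`, it keeps the input `n` and, once `x` is drawn, the point `x`, the letters still to be
followed and the current point. -/
def guard : OracleMachine d where
  Config := M.GuardConfig
  start n := .inr (n, none)
  move := M.guardMove
  next := M.guardNext w
  start_computable := Computable.sumInr.comp (Computable.id.pair (Computable.const none))
  move_computable := M.guardMove_computable
  next_computable := M.guardNext_computable w

theorem guard_evaluates_inl {n : ℕ} (σ : Fin d → Equiv.Perm (Fin n)) {c : M.Config} {q : ℕ}
    {p : ℝ} (h : M.Evaluates σ c q p) : (M.guard w).Evaluates σ (.inl c) q p := by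
  induction h with
  | accept c q hc => exact .accept (M := M.guard w) _ _ hc
  | reject c q hc => exact .reject (M := M.guard w) _ _ hc
  | query c q p i b x hc _ ih => exact .query (M := M.guard w) _ _ _ i b x hc ih
  | sample c q m p hc _ ih => exact .sample (M := M.guard w) _ _ m p hc ih

theorem guard_evaluates_word {n : ℕ} (σ : Fin d → Equiv.Perm (Fin n)) {q : ℕ} {p : ℝ}
    (h : M.Evaluates σ (M.start n) q p) (x : ℕ) (v : Word d) : ∀ y : ℕ,
    (M.guard w).Evaluates σ (.inr (n, some (x, v, y))) (q + v.length)
      (if Word.trace σ v y = x then p else 0) := by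
  induction v with
  | nil =>
    intro y
    by_cases hxy : y = x
    · simp only [Word.trace, List.foldl_nil, hxy, if_true]
      exact Evaluates.skip (M := M.guard w) (by simp [guard, guardMove])
        (M.guard_evaluates_inl w σ h)
    · simp only [Word.trace, List.foldl_nil, hxy, if_false]
      refine .reject (M := M.guard w) _ _ ?_
      have : (x == y) = false := by simpa using fun h => hxy h.symm
      simp [guard, guardMove, this]
  | cons s v ih =>
    exact fun y => Evaluates.query (M := M.guard w) _ _ _ s.1 s.2 y rfl (ih _)

/-- The check passes exactly at the fixed points of `g(σ)`, whose proportion is one minus the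
distance to the identity. The run of `M` that follows does not depend on the point drawn, so the
probabilities multiply. -/
theorem guard_evaluates {n : ℕ} (hn : 1 ≤ n) (g : FreeGroup (Fin d))
    (σ : Fin d → Equiv.Perm (Fin n)) {q : ℕ} {p : ℝ} (h : M.Evaluates σ (M.start n) q p) :
    (M.guard g.toWord.reverse).Evaluates σ ((M.guard g.toWord.reverse).start n)
      (q + g.toWord.length) (p * (1 - hammingDistance (FreeGroup.lift σ g) 1)) := by
  -- The guard draws with `sample (n - 1)`, which is uniform on `n` values only for positive `n`.
  obtain ⟨m, rfl⟩ : ∃ m, n = m + 1 := ⟨n - 1, by omega⟩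
  set π := FreeGroup.lift σ g with hπ
  have key := Evaluates.sample (M := M.guard g.toWord.reverse) (σ := σ)
    (.inr (m + 1, none)) (q + g.toWord.length) m
    (fun r => if π r = r then p else 0) rfl (fun r => by
      have := M.guard_evaluates_word g.toWord.reverse σ h r g.toWord.reverse r
      rw [Word.trace_reverse, Word.subst_eq_lift, FreeGroup.mk_toWord, List.length_reverse] at this
      have hr : oracleAnswer π true r = (r : ℕ) ↔ π r = r := by
        rw [oracleAnswer, dif_pos r.isLt]
        simp [Fin.ext_iff]
      simp only [← hπ, hr] at this
      exact this)
  suffices hp : p * (1 - hammingDistance π 1) =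
      (∑ r, if π r = r then p else 0) / ((m : ℝ) + 1) by rw [hp]; exact key
  have hc : ((Finset.univ.filter fun x => π x ≠ (1 : Equiv.Perm (Fin (m + 1))) x).card : ℝ) =
      (m + 1) - (Finset.univ.filter fun x => π x = x).card := by
    have := Finset.card_filter_add_card_filter_not (s := (Finset.univ : Finset (Fin (m + 1))))
      (fun x => π x = x)
    rw [Finset.card_univ, Fintype.card_fin] at this
    have h2 : ((Finset.univ.filter fun x => π x = x).card : ℝ) +
      (Finset.univ.filter fun x => ¬ π x = x).card = m + 1 := by exact_mod_cast this
    exact eq_sub_of_add_eq' h2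
  rw [hammingDistance, hc, ← Finset.sum_filter, Finset.sum_const, nsmul_eq_mul]
  push_cast
  field_simp
  ring

theorem exists_guard_list (gs : List (FreeGroup (Fin d))) : ∃ (M' : OracleMachine d) (L : ℕ),
    ∀ (n : ℕ) (σ : Fin d → Equiv.Perm (Fin n)) (q : ℕ) (p : ℝ), 1 ≤ n →
      M.Evaluates σ (M.start n) q p →
      M'.Evaluates σ (M'.start n) (q + L)
        (p * (gs.map fun g => 1 - hammingDistance (FreeGroup.lift σ g) 1).prod) := by
  induction gs with
  | nil => exact ⟨M, 0, fun n σ q p _ h => by simpa using h⟩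
  | cons g gs ih =>
    obtain ⟨M', L, hM⟩ := ih
    refine ⟨M'.guard g.toWord.reverse, L + g.toWord.length, fun n σ q p hn h => ?_⟩
    have := M'.guard_evaluates hn g σ (hM n σ q p hn h)
    rw [add_assoc] at this
    convert this using 1
    rw [List.map_cons, List.prod_cons]
    ring

theorem exists_guard_pow (r : Fin d → FreeGroup (Fin d)) (k : ℕ) :
    ∃ (M' : OracleMachine d) (L : ℕ),
      ∀ (n : ℕ) (σ : Fin d → Equiv.Perm (Fin n)) (q : ℕ) (p : ℝ), 1 ≤ n →
        M.Evaluates σ (M.start n) q p →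
        M'.Evaluates σ (M'.start n) (q + L)
          (p * (∏ j, (1 - hammingDistance (FreeGroup.lift σ (r j)) 1)) ^ k) := by
  induction k with
  | zero => exact ⟨M, 0, fun n σ q p _ h => by simpa using h⟩
  | succ k ih =>
    obtain ⟨M₁, L₁, h₁⟩ := ih
    obtain ⟨M₂, L₂, h₂⟩ := M₁.exists_guard_list (List.ofFn r)
    refine ⟨M₂, L₁ + L₂, fun n σ q p hn h => ?_⟩
    have := h₂ n σ _ _ hn (h₁ n σ q p hn h)
    rw [List.map_ofFn, List.prod_ofFn, mul_assoc, add_assoc] at this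
    rw [pow_succ]
    exact this

end Guard

end OracleMachine

/-! ### Solutions as homomorphisms, and transfer along an isomorphism -/

namespace EqSystem

theorem mem_solutions_iff {d n : ℕ} (E : EqSystem d) (σ : Fin d → Equiv.Perm (Fin n)) :
    σ ∈ E.solutions n ↔ ∀ r ∈ E.relators, FreeGroup.lift σ r = 1 := by
  constructor
  · rintro h r ⟨e, he, rfl⟩
    have := h e he
    rw [Word.subst_eq_lift, Word.subst_eq_lift] at this
    rw [map_mul, map_inv, this, mul_inv_cancel]
  · intro h e he
    have := h _ ⟨e, he, rfl⟩
    rw [map_mul, map_inv, mul_inv_eq_one] at this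
    rw [Word.subst_eq_lift, Word.subst_eq_lift, this]

theorem solutions_of_hom {d n : ℕ} (E : EqSystem d)
    (ψ : E.presentedGroup →* Equiv.Perm (Fin n)) :
    (fun i => ψ (PresentedGroup.of i)) ∈ E.solutions n := by
  rw [mem_solutions_iff]
  intro r hr
  have : FreeGroup.lift (fun i => ψ (PresentedGroup.of i)) = ψ.comp (PresentedGroup.mk _) := by
    ext1 i
    simp [PresentedGroup.of]
  rw [this, MonoidHom.comp_apply, PresentedGroup.one_of_mem hr, map_one]

/-- The homomorphism from the presented group that a solution defines. -/
theorem exists_hom_of_mem_solutions {d n : ℕ} {E : EqSystem d}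
    {σ : Fin d → Equiv.Perm (Fin n)} (h : σ ∈ E.solutions n) :
    ∃ ψ : E.presentedGroup →* Equiv.Perm (Fin n),
      ∀ g, FreeGroup.lift σ g = ψ (PresentedGroup.mk _ g) :=
  ⟨PresentedGroup.toGroup ((E.mem_solutions_iff σ).1 h), fun _ => rfl⟩

theorem exists_lift_hom {d e : ℕ} {E : EqSystem d} {F : EqSystem e}
    (f : E.presentedGroup →* F.presentedGroup) :
    ∃ a : Fin d → FreeGroup (Fin e), ∀ i,
      PresentedGroup.mk F.relators (a i) = f (PresentedGroup.of i) :=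
  ⟨fun i => (PresentedGroup.mk_surjective _ (f (PresentedGroup.of i))).choose,
    fun i => (PresentedGroup.mk_surjective _ (f (PresentedGroup.of i))).choose_spec⟩

/-- Precomposing the homomorphism of a solution of `F` with `f` gives a solution of `E`; the choice
of the lifts `a` is immaterial. -/
theorem pull_mem_solutions {d e n : ℕ} {E : EqSystem d} {F : EqSystem e}
    {f : E.presentedGroup →* F.presentedGroup} {a : Fin d → FreeGroup (Fin e)}
    (ha : ∀ i, PresentedGroup.mk F.relators (a i) = f (PresentedGroup.of i))
    {σ : Fin e → Equiv.Perm (Fin n)} (h : σ ∈ F.solutions n) :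
    (fun i => FreeGroup.lift σ (a i)) ∈ E.solutions n := by
  obtain ⟨ψ, hψ⟩ := exists_hom_of_mem_solutions h
  have := E.solutions_of_hom (ψ.comp f)
  simpa only [hψ, ha, MonoidHom.comp_apply] using this

theorem mk_lift_eq {d e : ℕ} {E : EqSystem d} {F : EqSystem e}
    {f : E.presentedGroup →* F.presentedGroup} {a : Fin d → FreeGroup (Fin e)}
    (ha : ∀ i, PresentedGroup.mk F.relators (a i) = f (PresentedGroup.of i))
    (g : FreeGroup (Fin d)) :
    PresentedGroup.mk F.relators (FreeGroup.lift a g) = f (PresentedGroup.mk _ g) := by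
  have : (PresentedGroup.mk F.relators).comp (FreeGroup.lift a) =
      f.comp (PresentedGroup.mk E.relators) := by
    ext1 i
    simpa [PresentedGroup.of] using ha i
  exact DFunLike.congr_fun this g

theorem lift_lift {d e n : ℕ} (a : Fin d → FreeGroup (Fin e)) (σ : Fin e → Equiv.Perm (Fin n))
    (g : FreeGroup (Fin d)) :
    FreeGroup.lift σ (FreeGroup.lift a g) =
      FreeGroup.lift (fun i => FreeGroup.lift σ (a i)) g := by
  have : (FreeGroup.lift σ).comp (FreeGroup.lift a) =
      FreeGroup.lift (fun i => FreeGroup.lift σ (a i)) := by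
    ext1 i
    simp
  exact DFunLike.congr_fun this g

theorem Testable.of_mulEquiv {d e : ℕ} {E : EqSystem d} {F : EqSystem e}
    (f : E.presentedGroup ≃* F.presentedGroup) (hE : E.Testable) : F.Testable := by
  intro ε hε
  obtain ⟨a, ha⟩ := exists_lift_hom f.toMonoidHom
  obtain ⟨b, hb⟩ := exists_lift_hom f.symm.toMonoidHom
  set C : ℝ := ∑ j, ((b j).toWord.length : ℝ) with hC
  have hC0 : 0 ≤ C := Finset.sum_nonneg fun _ _ => Nat.cast_nonneg _
  -- `C` bounds the Lipschitz constant of `b`, so this precision becomes at most `ε / 2` after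
  -- applying `b`; `C + 1` avoids division by zero.
  obtain ⟨q, M, hM⟩ := hE (ε / (2 * (C + 1))) (by positivity)
  -- In the critical case one round of checks passes with probability at most `exp (-(ε / 2))`,
  -- whatever `n` is.
  obtain ⟨k, hk⟩ : ∃ k : ℕ, Real.exp (-(ε / 2)) ^ k < 0.01 :=
    exists_pow_lt_of_lt_one (by norm_num) (by rw [Real.exp_lt_one_iff]; linarith)
  obtain ⟨M₁, L₁, h₁⟩ := M.exists_pull a
  obtain ⟨M₂, L₂, h₂⟩ := M₁.exists_guard_pow
    (fun j => (FreeGroup.of j)⁻¹ * FreeGroup.lift a (b j)) k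
  refine ⟨q * L₁ + L₂, M₂, fun n hn σ => ?_⟩
  obtain ⟨p, hp, hsol, hfar⟩ := hM n hn fun i => FreeGroup.lift σ (a i)
  set P : ℝ := ∏ j, (1 - hammingDistance (FreeGroup.lift σ
    ((FreeGroup.of j)⁻¹ * FreeGroup.lift a (b j))) 1) with hP
  have hdist : ∀ j, hammingDistance (FreeGroup.lift σ
      ((FreeGroup.of j)⁻¹ * FreeGroup.lift a (b j))) 1 =
      hammingDistance (σ j) (FreeGroup.lift (fun i => FreeGroup.lift σ (a i)) (b j)) := by
    intro j
    rw [← hammingDistance_mul_left (σ j), map_mul, map_inv, FreeGroup.lift_apply_of, lift_lift,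
      mul_inv_cancel_left, mul_one, hammingDistance_comm]
  have hP0 : 0 ≤ P := Finset.prod_nonneg fun j _ => by
    linarith [hammingDistance_le_one (FreeGroup.lift σ
      ((FreeGroup.of j)⁻¹ * FreeGroup.lift a (b j))) 1]
  have hP1 : P ≤ 1 := Finset.prod_le_one
    (fun j _ => sub_nonneg.2 (hammingDistance_le_one _ _))
    (fun j _ => sub_le_self _ (hammingDistance_nonneg _ _))
  obtain ⟨hp0, hp1⟩ := hp.mem_Icc
  refine ⟨p * P ^ k, h₂ n σ _ _ hn (h₁ n σ q p hp), fun hσ => ?_, fun hσ => ?_⟩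
  · have hone : P = 1 := by
      refine Finset.prod_eq_one fun j _ => ?_
      obtain ⟨ψ, hψ⟩ := exists_hom_of_mem_solutions hσ
      have : FreeGroup.lift σ ((FreeGroup.of j)⁻¹ * FreeGroup.lift a (b j)) = 1 := by
        rw [hψ, map_mul, mk_lift_eq ha, hb, map_inv]
        simp [PresentedGroup.of]
      rw [this, hammingDistance_self, sub_zero]
    rw [hone, one_pow, mul_one]
    exact hsol (pull_mem_solutions ha hσ)
  -- In the far case `M` itself rejects, and the checks can only lower the acceptance probability;
  -- otherwise the checks must do the rejecting.
  · by_cases hα : (fun i => FreeGroup.lift σ (a i)) ∈ E.farFromSolutions (ε / (2 * (C + 1))) n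
    · have := hfar hα
      nlinarith [mul_le_mul_of_nonneg_left (pow_le_one₀ (n := k) hP0 hP1) hp0]
    · obtain ⟨τ, hτ, hlt⟩ : ∃ τ ∈ E.solutions n,
          ∑ i, hammingDistance (FreeGroup.lift σ (a i)) (τ i) < ε / (2 * (C + 1)) := by
        simpa [farFromSolutions] using hα
      have hβ := hσ _ (pull_mem_solutions hb hτ)
      have hlip : ∑ j, hammingDistance (FreeGroup.lift (fun i => FreeGroup.lift σ (a i)) (b j))
          (FreeGroup.lift τ (b j)) ≤ ε / 2 := by
        calc _ ≤ ∑ j, ((b j).toWord.length : ℝ) *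
              ∑ i, hammingDistance (FreeGroup.lift σ (a i)) (τ i) := by
              refine Finset.sum_le_sum fun j _ => ?_
              have := hammingDistance_subst_le (b j).toWord (fun i => FreeGroup.lift σ (a i)) τ
              rwa [Word.subst_eq_lift, Word.subst_eq_lift, FreeGroup.mk_toWord] at this
          _ = C * ∑ i, hammingDistance (FreeGroup.lift σ (a i)) (τ i) := by
              rw [← Finset.sum_mul]
          _ ≤ (C + 1) * (ε / (2 * (C + 1))) :=
              mul_le_mul (by linarith) hlt.le
                (Finset.sum_nonneg fun _ _ => hammingDistance_nonneg _ _) (by linarith)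
          _ = ε / 2 := by field_simp
      -- `σ` is at distance at least `ε` from the solution `b(τ)`, while `b(a(σ))` is within `ε / 2`
      -- of it.
      have hsum : ε / 2 ≤ ∑ j, hammingDistance (σ j)
          (FreeGroup.lift (fun i => FreeGroup.lift σ (a i)) (b j)) := by
        have := Finset.sum_le_sum fun j (_ : j ∈ Finset.univ) => hammingDistance_triangle (σ j)
          (FreeGroup.lift (fun i => FreeGroup.lift σ (a i)) (b j)) (FreeGroup.lift τ (b j))
        rw [Finset.sum_add_distrib] at this
        linarith
      have hPexp : P ≤ Real.exp (-(ε / 2)) := by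
        calc P ≤ ∏ j, Real.exp (-hammingDistance (σ j)
              (FreeGroup.lift (fun i => FreeGroup.lift σ (a i)) (b j))) := by
              refine Finset.prod_le_prod
                (fun j _ => sub_nonneg.2 (hammingDistance_le_one _ _)) fun j _ => ?_
              rw [hdist]
              exact Real.one_sub_le_exp_neg _
          _ = Real.exp (-∑ j, hammingDistance (σ j)
              (FreeGroup.lift (fun i => FreeGroup.lift σ (a i)) (b j))) := by
              rw [← Real.exp_sum, Finset.sum_neg_distrib]
          _ ≤ _ := Real.exp_le_exp.2 (neg_le_neg hsum)
      have hPk : P ^ k < 0.01 := (pow_le_pow_left₀ hP0 hPexp k).trans_lt hk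
      have : p * P ^ k ≤ 1 * P ^ k := mul_le_mul_of_nonneg_right hp1 (pow_nonneg hP0 k)
      norm_num at hPk ⊢
      linarith

end EqSystem

theorem proposition1p5 (d₁ d₂ : ℕ) (E₁ : EqSystem d₁) (E₂ : EqSystem d₂)
    (h : Nonempty (E₁.presentedGroup ≃* E₂.presentedGroup)) :
    E₁.Testable ↔ E₂.Testable := by
  obtain ⟨f⟩ := h
  exact ⟨EqSystem.Testable.of_mulEquiv f, EqSystem.Testable.of_mulEquiv f.symm⟩
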